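/- Let $n\ge 1$, let $\mathbb{U}_1,\dots,\mathbb{U}_n$ be finite sets with $|\mathbb{U}_i|=u_i\ge 2$, let $\mathbb{X}=\prod_{i=1}^n\mathbb{U}_i$, let $\mathbb{F}$ be a field of characteristic $p$ (where $p=0$ is allowed, $0\mid k$ means $k=0$, and $u\equiv 1\pmod 0$ means $u=1$), and fix $\mathbf{x}\in\mathbb{X}$. For $g\subseteq\{1,\dots,n\}$ let $$R_g=\{(\mathbf{y},\mathbf{z})\in\mathbb{X}\times\mathbb{X}:\ \mathbf{y}_i\ne\mathbf{z}_i\iff i\in g\},\qquad k_g=|\{\mathbf{y}:(\mathbf{x},\mathbf{y})\in R_g\}|$$ (these are the relations of the factorial scheme with parameters $u_1,\dots,u_n$ and their valencies). Let $A_g$ be the $\{0,1\}$-matrix over $\mathbb{F}$, with rows and columns indexed by $\mathbb{X}$, whose $(\mathbf{y},\mathbf{z})$-entry is $1$ if and only if $(\mathbf{y},\mathbf{z})\in R_g$, and let $E_g^*$ be the diagonal $\{0,1\}$-matrix whose $(\mathbf{y},\mathbf{y})$-entry is $1$ if and only if $(\mathbf{x},\mathbf{y})\in R_g$. Let $\mathbb{T}$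 be the unital $\mathbb{F}$-subalgebra of $\mathrm{M}_{\mathbb{X}}(\mathbb{F})$ generated by all $A_g$ and all $E_g^*$ (the Terwilliger $\mathbb{F}$-algebra with respect to $\mathbf{x}$). For $a,b\subseteq\{1,\dots,n\}$ put $a\oplus b=(a\setminus b)\cup(b\setminus a)$ and $a\odot b=(a\oplus b)\cup\{i\in a\cap b: u_i>2\}$. For $a,b,c$ with $a\oplus b\subseteq c\subseteq a\odot b$ put $$B_{a,b,c}=\sum_{a\oplus c\,\subseteq\, j\,\subseteq\, b}E_a^*A_jE_c^*\in\mathbb{T}.$$ Let $\mathrm{Rad}(\mathbb{T})$ be the Jacobson radical of $\mathbb{T}$, that is, the sum of all nilpotent two-sided ideals of $\mathbb{T}$. Then $\mathrm{Rad}(\mathbb{T})$ is the $\mathbb{F}$-linear span of $\{B_{a,b,c}:\ a\oplus b\subseteq c\subseteq a\odot b,\ p\mid k_b\}$. Moreover, the nilpotency of $\mathrm{Rad}(\mathbb{T})$, i.e. the smallest $h\ge 1$ such that the product of any $h$ elements of $\mathrm{Rad}(\mathbb{T})$ is zero, equals $2\,|\{a\in\{1,\dots,n\}:\ u_a\equiv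 1\pmod p\}|+1$. -/

import Mathlib

namespace FactorialScheme

section NilpotentIdeals

variable {A : Type*} [Ring A]

/-- The product of any `h` elements of the two-sided ideal `I` is zero. -/
def ProductsVanish (I : TwoSidedIdeal A) (h : ℕ) : Prop :=
  ∀ f : Fin h → A, (∀ i, f i ∈ I) → (List.ofFn f).prod = 0

/-- A two-sided ideal is nilpotent if, for some `h ≥ 1`, the product of any `h` of its
elements is zero. -/
def IsNilpotentIdeal (I : TwoSidedIdeal A) : Prop :=
  ∃ h : ℕ, 1 ≤ h ∧ ProductsVanish I h

/-- `I` is nilpotent and `m` is its nilpotency: the smallest `h ≥ 1` such that the product of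
any `h` elements of `I` is zero. -/
def HasNilpotency (I : TwoSidedIdeal A) (m : ℕ) : Prop :=
  IsLeast {h : ℕ | 1 ≤ h ∧ ProductsVanish I h} m

variable (A) in
/-- The Jacobson radical (of a finite-dimensional algebra): the sum of all nilpotent two-sided
ideals. -/
def rad : TwoSidedIdeal A :=
  sSup {I : TwoSidedIdeal A | IsNilpotentIdeal I}

end NilpotentIdeals

noncomputable section Scheme

/- The relations of the factorial scheme on `∏ i, U i` are indexed by the subsets of `Fin n`:
the index `g` in `{0, …, 2 ^ n - 1}` is identified with the set of positions at which its binary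
expansion has the digit one, so that the order, union, intersection and difference of indices
are those of sets. -/
variable {n : ℕ} {U : Fin n → Type*} [∀ i, Fintype (U i)] [∀ i, DecidableEq (U i)]

/-- `(y, z) ∈ R_g`: the coordinates at which `y` and `z` differ are exactly those in `g`. -/
def Rel (g : Finset (Fin n)) (y z : ∀ i, U i) : Prop :=
  ∀ i, y i ≠ z i ↔ i ∈ g

instance (g : Finset (Fin n)) (y z : ∀ i, U i) : Decidable (Rel g y z) :=
  inferInstanceAs (Decidable (∀ i, y i ≠ z i ↔ i ∈ g))

/-- The valency `k_g` of `R_g`, computed at the point `x`: the cardinality of `x R_g`. (It does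
not depend on `x`.) -/
def valency (x : ∀ i, U i) (g : Finset (Fin n)) : ℕ :=
  Fintype.card {y : ∀ i, U i // Rel g x y}

variable (U) in
/-- `P₂(g)`, the set of the positions in `g` whose factor has more than two elements; this is
the index written `g` with a tilde. -/
def tilde (g : Finset (Fin n)) : Finset (Fin n) :=
  g.filter fun i => 2 < Fintype.card (U i)

/-- `g ⊕ h`. -/
def oplus (g h : Finset (Fin n)) : Finset (Fin n) :=
  (g \ h) ∪ (h \ g)

variable (U) in
/-- `g ⊙ h`. -/
def odot (g h : Finset (Fin n)) : Finset (Fin n) :=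
  oplus g h ∪ tilde U (g ∩ h)

variable (F : Type*) [Field F]

/-- The adjacency matrix `A_g` over `F`. -/
def adjMatrix (g : Finset (Fin n)) : Matrix (∀ i, U i) (∀ i, U i) F :=
  Matrix.of fun y z => if Rel g y z then 1 else 0

/-- The dual idempotent `E_g^*(x)` over `F`. -/
def dualIdempotent (x : ∀ i, U i) (g : Finset (Fin n)) : Matrix (∀ i, U i) (∀ i, U i) F :=
  Matrix.diagonal fun y => if Rel g x y then 1 else 0

/-- The Terwilliger algebra of the factorial scheme over `F` with respect to `x`: the unital
subalgebra generated by all dual idempotents and all adjacency matrices. -/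
def terwilligerAlgebra (x : ∀ i, U i) : Subalgebra F (Matrix (∀ i, U i) (∀ i, U i) F) :=
  Algebra.adjoin F (Set.range (dualIdempotent F x) ∪ Set.range (adjMatrix F))

/-- The adjacency matrix `A_g` as an element of the Terwilliger algebra. -/
def elemA (x : ∀ i, U i) (g : Finset (Fin n)) : terwilligerAlgebra F x :=
  ⟨adjMatrix F g, Algebra.subset_adjoin (Or.inr ⟨g, rfl⟩)⟩

/-- The dual idempotent `E_g^*(x)` as an element of the Terwilliger algebra. -/
def elemE (x : ∀ i, U i) (g : Finset (Fin n)) : terwilligerAlgebra F x :=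
  ⟨dualIdempotent F x g, Algebra.subset_adjoin (Or.inl ⟨g, rfl⟩)⟩

/-- `B_{g,h,i}`, the sum of `E_g^* A_j E_i^*` over all `j` with `g ⊕ i ⊆ j ⊆ h`. -/
def elemB (x : ∀ i, U i) (g h i : Finset (Fin n)) : terwilligerAlgebra F x :=
  ∑ j ∈ Finset.Icc (oplus g i) h, elemE F x g * elemA F x j * elemE F x i

/-- The `F`-span of the `B_{a,b,c}` with `a ⊕ b ⊆ c ⊆ a ⊙ b` and `p ∣ k_b`. -/
def spanB (p : ℕ) (x : ∀ i, U i) : Submodule F (terwilligerAlgebra F x) :=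
  Submodule.span F {M | ∃ a b c : Finset (Fin n),
    oplus a b ⊆ c ∧ c ⊆ odot U a b ∧ p ∣ valency x b ∧ M = elemB F x a b c}

end Scheme

end FactorialScheme

/-! The algebra `T` is the Kronecker product of the Terwilliger algebras of the one-class schemes on
the factors, so the structure is decided in one coordinate `V` with `k = |V| - 1` taken in `F`. That
algebra is spanned by `eps` and the four blocks of the all-ones matrix cut out by the base point and
its complement. If `k ≠ 0`, the blocks span a 2 by 2 matrix algebra and `eps` is an idempotent
(possibly zero) annihilating it on both sides, so there is no radical. If `k = 0`, nonzero products
of blocks add their weights; positive weight spans the radical, and the largest weight is 2.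

Multiplying the coordinate filtrations together gives `filt`. Its step 0 is `T`; its step 1 is an
ideal in which a product of `2m + 1` elements vanishes, where `m` is the number of positions with `k
= 0` (`eq_zero_of_mem_filt`), while some product of `2m` elements survives
(`exists_list_prod_ne_zero`). Every nilpotent ideal lies in step 1, because modulo it a nonzero
element can be compressed to a nonzero multiple of an idempotent (`mem_filt_one_of_isNilpotent`).

The stated spanning set appears because `B_{a,b,c}` is itself a Kronecker product, with blocks at
the positions of `b` (`elemB_eq_tens`); since `k_b` is the product of the coordinate valencies over
`b`, `p ∣ k_b` says that one of these blocks sits at a position with `k = 0` (`dvd_valency_iff`). -/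

namespace FactorialScheme

/-! ### The algebra of a one-class scheme and its radical filtration. -/

noncomputable section Coordinate

open Matrix

set_option linter.unusedSectionVars false

variable (F : Type*) [Field F] {V : Type*} [Fintype V] [DecidableEq V] (v : V)

variable (V) in
/-- The nontrivial valency `|V| - 1` of the one-class scheme on `V`, as an element of `F`. -/
def coordValency : F := (Fintype.card V : F) - 1

/-- The indicator function of `{v}` (for `false`) or of its complement (for `true`). -/
def ind (s : Bool) : V → F := fun y => if decide (y ≠ v) = s then 1 else 0

/-- The `(s, t)` block of the all-ones matrix. -/
def block (s t : Bool) : Matrix V V F := vecMulVec (ind F v s) (ind F v t)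

/-- The idempotent of the one-class scheme which is orthogonal to all blocks, when the valency is
invertible; the second dual idempotent otherwise. -/
def eps : Matrix V V F := diagonal (ind F v true) - (coordValency F V)⁻¹ • block F v true true

/-- A spanning family of the Terwilliger algebra of the one-class scheme on `V`. -/
def coordBasis : Option (Bool × Bool) → Matrix V V F
  | none => eps F v
  | some (s, t) => block F v s t

/-- The depth of the elements of `coordBasis` in the radical, when the valency vanishes. -/
def weight : Option (Bool × Bool) → ℕ
  | none => 0
  | some (s, t) => s.toNat + t.toNat

/-- The radical filtration of the Terwilliger algebra of the one-class scheme. -/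
def coordFilt (d : ℕ) : Submodule F (Matrix V V F) :=
  Submodule.span F (coordBasis F v '' {o | d = 0 ∨ (coordValency F V = 0 ∧ d ≤ weight o)})

variable {F}

lemma ind_mul_ind (s t : Bool) (y : V) :
    ind F v s y * ind F v t y = if s = t then ind F v s y else 0 := by
  unfold ind
  cases s <;> cases t <;> by_cases h : y = v <;> simp [h]

lemma sum_ind (s : Bool) : ∑ y, ind F v s y = if s then coordValency F V else 1 := by
  cases s
  · simp [ind]
  · have h : ∀ y, ind F v true y = 1 - if y = v then 1 else 0 := by
      intro y
      by_cases h : y = v <;> simp [ind, h]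
    simp [h, coordValency]

lemma ind_dotProduct_ind (s t : Bool) :
    ind F v s ⬝ᵥ ind F v t = if s = t then (if s then coordValency F V else 1) else 0 := by
  simp only [dotProduct, ind_mul_ind]
  split_ifs with h h'
  · rw [sum_ind, if_pos h']
  · rw [sum_ind, if_neg h']
  · simp

lemma block_mul_block (s t s' t' : Bool) :
    block F v s t * block F v s' t' =
      (if t = s' then (if t then coordValency F V else 1) else 0) • block F v s t' := by
  rw [block, block, vecMulVec_mul_vecMulVec, ind_dotProduct_ind]
  rw [block, vecMulVec_smul]

lemma diagonal_ind_mul_diagonal_ind (s t : Bool) :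
    diagonal (ind F v s) * diagonal (ind F v t) =
      if s = t then diagonal (ind F v s) else 0 := by
  rw [diagonal_mul_diagonal]
  simp only [ind_mul_ind]
  split_ifs <;> simp

lemma diagonal_ind_mul_block (r s t : Bool) :
    diagonal (ind F v r) * block F v s t = if r = s then block F v s t else 0 := by
  ext y z
  rw [diagonal_mul, block, vecMulVec_apply, ← mul_assoc, ind_mul_ind]
  split_ifs with h <;> simp [vecMulVec_apply, h]

lemma block_mul_diagonal_ind (r s t : Bool) :
    block F v s t * diagonal (ind F v r) = if t = r then block F v s t else 0 := by
  ext y z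
  rw [mul_diagonal, block, vecMulVec_apply, mul_assoc, ind_mul_ind]
  split_ifs with h <;> simp [vecMulVec_apply]

/-- As `0⁻¹ = 0`, the scalar `1 - k⁻¹ * k` is 0 for `k ≠ 0` and 1 for `k = 0`, so both cases are
treated at once. -/
lemma eps_mul_block (s t : Bool) :
    eps F v * block F v s t =
      (if s then 1 - (coordValency F V)⁻¹ * coordValency F V else 0) • block F v s t := by
  rw [eps, sub_mul, diagonal_ind_mul_block, smul_mul_assoc, block_mul_block]
  cases s <;> simp [sub_smul, mul_smul]

lemma block_mul_eps (s t : Bool) :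
    block F v s t * eps F v =
      (if t then 1 - (coordValency F V)⁻¹ * coordValency F V else 0) • block F v s t := by
  rw [eps, mul_sub, block_mul_diagonal_ind, mul_smul_comm, block_mul_block]
  cases t <;> simp [sub_smul, mul_smul]

lemma eps_mul_eps : eps F v * eps F v = eps F v := by
  conv_lhs => rw [eps, mul_sub, mul_smul_comm]
  rw [← eps, eps_mul_block]
  have h : (coordValency F V)⁻¹ * (1 - (coordValency F V)⁻¹ * coordValency F V) = 0 := by
    by_cases h : coordValency F V = 0 <;> simp [h]
  rw [if_pos rfl, smul_smul, h, zero_smul, sub_zero, eps, sub_mul, smul_mul_assoc,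
    block_mul_diagonal_ind, diagonal_ind_mul_diagonal_ind]
  simp

/-- For `k = 0`, two blocks have a nonzero product only when the inner indices are both `false`;
these carry no weight, so no weight is lost. -/
lemma exists_coordBasis_mul (o o' : Option (Bool × Bool)) :
    ∃ (c : F) (o'' : Option (Bool × Bool)),
      coordBasis F v o * coordBasis F v o' = c • coordBasis F v o'' ∧
        (coordValency F V = 0 → c = 0 ∨ weight o + weight o' ≤ weight o'') := by
  rcases o with _ | ⟨s, t⟩ <;> rcases o' with _ | ⟨s', t'⟩
  · exact ⟨1, none, by simp [coordBasis, eps_mul_eps], fun _ => Or.inr (by simp [weight])⟩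
  · exact ⟨_, some (s', t'), eps_mul_block v s' t', fun _ => Or.inr (by simp [weight])⟩
  · exact ⟨_, some (s, t), block_mul_eps v s t, fun _ => Or.inr (by simp [weight])⟩
  · refine ⟨_, some (s, t'), block_mul_block v s t s' t', fun h => ?_⟩
    rw [h]
    cases t <;> cases s' <;> simp [weight]

lemma coordBasis_mem_coordFilt {d : ℕ} {o : Option (Bool × Bool)}
    (h : d = 0 ∨ (coordValency F V = 0 ∧ d ≤ weight o)) :
    coordBasis F v o ∈ coordFilt F v d :=
  Submodule.subset_span ⟨o, h, rfl⟩

lemma coordFilt_mul_mem {d e : ℕ} {M N : Matrix V V F} (hM : M ∈ coordFilt F v d)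
    (hN : N ∈ coordFilt F v e) : M * N ∈ coordFilt F v (d + e) := by
  have key : coordFilt F v d * coordFilt F v e ≤ coordFilt F v (d + e) := by
    rw [coordFilt, coordFilt, Submodule.span_mul_span, Submodule.span_le]
    rintro _ ⟨_, ⟨o, ho, rfl⟩, _, ⟨o', ho', rfl⟩, rfl⟩
    obtain ⟨c, o'', h, hc⟩ := exists_coordBasis_mul (F := F) v o o'
    simp only [h]
    by_cases hc0 : c = 0
    · simp [hc0]
    · refine Submodule.smul_mem _ _ (coordBasis_mem_coordFilt v ?_)
      simp only [Set.mem_ofPred_eq] at ho ho'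
      by_cases hk : coordValency F V = 0
      · have := (hc hk).resolve_left hc0
        refine Or.inr ⟨hk, ?_⟩
        rcases ho with rfl | ⟨-, ho⟩ <;> rcases ho' with rfl | ⟨-, ho'⟩ <;> omega
      · simp only [hk, false_and, or_false] at ho ho'
        left; omega
  exact key (Submodule.mul_mem_mul hM hN)

lemma weight_le_two (o : Option (Bool × Bool)) : weight o ≤ 2 := by
  rcases o with _ | ⟨s, t⟩
  · simp [weight]
  · cases s <;> cases t <;> simp [weight]

lemma le_two_of_mem_coordFilt {d : ℕ} {M : Matrix V V F} (hM : M ∈ coordFilt F v d)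
    (h0 : M ≠ 0) : d ≤ 2 ∧ (coordValency F V ≠ 0 → d = 0) := by
  by_contra hd
  apply h0
  rw [← Submodule.mem_bot F]
  refine (Submodule.span_le.2 ?_) hM
  rintro _ ⟨o, ho, rfl⟩
  refine absurd ?_ hd
  rcases ho with rfl | ⟨hk, ho⟩
  · exact ⟨by omega, fun _ => rfl⟩
  · exact ⟨ho.trans (weight_le_two o), fun h => absurd hk h⟩

lemma diagonal_ind_false : diagonal (ind F v false) = block F v false false := by
  ext y z
  simp only [block, vecMulVec_apply, ind, diagonal_apply]
  by_cases h : y = v <;> by_cases h' : z = v <;> by_cases h'' : y = z <;> simp_all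

lemma diagonal_ind_true :
    diagonal (ind F v true) = eps F v + (coordValency F V)⁻¹ • block F v true true := by
  simp [eps]

lemma block_mem_coordFilt_zero (s t : Bool) : block F v s t ∈ coordFilt F v 0 :=
  coordBasis_mem_coordFilt (o := some (s, t)) v (Or.inl rfl)

lemma eps_mem_coordFilt_zero : eps F v ∈ coordFilt F v 0 :=
  coordBasis_mem_coordFilt (o := none) v (Or.inl rfl)

lemma diagonal_ind_mem_coordFilt_zero (s : Bool) : diagonal (ind F v s) ∈ coordFilt F v 0 := by
  cases s
  · rw [diagonal_ind_false]
    exact block_mem_coordFilt_zero v _ _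
  · rw [diagonal_ind_true]
    exact add_mem (eps_mem_coordFilt_zero v)
      (Submodule.smul_mem _ _ (block_mem_coordFilt_zero v _ _))

lemma one_eq_add_diagonal_ind :
    (1 : Matrix V V F) = diagonal (ind F v false) + diagonal (ind F v true) := by
  rw [diagonal_add, ← diagonal_one]
  congr 1
  ext y
  by_cases h : y = v <;> simp [ind, h]

lemma one_mem_coordFilt_zero : (1 : Matrix V V F) ∈ coordFilt F v 0 := by
  rw [one_eq_add_diagonal_ind v]
  exact add_mem (diagonal_ind_mem_coordFilt_zero v _) (diagonal_ind_mem_coordFilt_zero v _)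

lemma ones_eq_sum_block :
    (Matrix.of fun _ _ => 1 : Matrix V V F) =
      block F v false false + block F v false true + block F v true false +
        block F v true true := by
  ext y z
  by_cases h : y = v <;> by_cases h' : z = v <;> simp [block, vecMulVec_apply, ind, h, h']

lemma compl_one_mem_coordFilt_zero :
    (Matrix.of fun y z => if y ≠ z then 1 else 0 : Matrix V V F) ∈ coordFilt F v 0 := by
  have h : (Matrix.of fun y z => if y ≠ z then 1 else 0 : Matrix V V F) =
      (Matrix.of fun _ _ => 1) - 1 := by
    ext y z
    by_cases h : y = z <;> simp [h, one_apply]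
  rw [h, ones_eq_sum_block v]
  refine sub_mem ?_ (one_mem_coordFilt_zero v)
  exact add_mem (add_mem (add_mem (block_mem_coordFilt_zero v _ _)
    (block_mem_coordFilt_zero v _ _)) (block_mem_coordFilt_zero v _ _))
    (block_mem_coordFilt_zero v _ _)

/-! ### Compression to primitive idempotents in one coordinate. -/

/-- The element carrying `coordBasis o` to a multiple of `cornerIdem o`, from the left. -/
def cornerLeft : Option (Bool × Bool) → Matrix V V F
  | none => eps F v
  | some (s, _) => block F v false s

/-- The element carrying `coordBasis o` to a multiple of `cornerIdem o`, from the right. -/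
def cornerRight : Option (Bool × Bool) → Matrix V V F
  | none => eps F v
  | some (_, t) => block F v t false

/-- A primitive idempotent in the simple component of `coordBasis o`. -/
def cornerIdem : Option (Bool × Bool) → Matrix V V F
  | none => eps F v
  | some _ => block F v false false

lemma cornerLeft_mem (o : Option (Bool × Bool)) : cornerLeft (F := F) v o ∈ coordFilt F v 0 := by
  rcases o with _ | ⟨s, t⟩
  · exact eps_mem_coordFilt_zero v
  · exact block_mem_coordFilt_zero v _ _

lemma cornerRight_mem (o : Option (Bool × Bool)) :
    cornerRight (F := F) v o ∈ coordFilt F v 0 := by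
  rcases o with _ | ⟨s, t⟩
  · exact eps_mem_coordFilt_zero v
  · exact block_mem_coordFilt_zero v _ _

lemma cornerIdem_mem (o : Option (Bool × Bool)) : cornerIdem (F := F) v o ∈ coordFilt F v 0 := by
  rcases o with _ | ⟨s, t⟩
  · exact eps_mem_coordFilt_zero v
  · exact block_mem_coordFilt_zero v _ _

lemma cornerIdem_mul_self (o : Option (Bool × Bool)) :
    cornerIdem (F := F) v o * cornerIdem v o = cornerIdem v o := by
  rcases o with _ | ⟨s, t⟩
  · exact eps_mul_eps v
  · simp [cornerIdem, block_mul_block]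

lemma block_false_false_ne_zero : block F v false false ≠ 0 := by
  intro h
  have := congrFun (congrFun h v) v
  simp [block, vecMulVec_apply, ind] at this

lemma cornerIdem_ne_zero {o : Option (Bool × Bool)} (h : coordBasis F v o ≠ 0) :
    cornerIdem (F := F) v o ≠ 0 := by
  rcases o with _ | ⟨s, t⟩
  · exact h
  · exact block_false_false_ne_zero v

lemma exists_corner_self {o : Option (Bool × Bool)} (ho : coordValency F V ≠ 0 ∨ weight o = 0) :
    ∃ c : F, c ≠ 0 ∧
      cornerLeft v o * coordBasis F v o * cornerRight v o = c • cornerIdem v o := by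
  rcases o with _ | ⟨s, t⟩
  · exact ⟨1, one_ne_zero, by
      simp [cornerLeft, coordBasis, cornerRight, cornerIdem, eps_mul_eps]⟩
  · refine ⟨(if s then coordValency F V else 1) * (if t then coordValency F V else 1), ?_, ?_⟩
    · rcases ho with h | h
      · cases s <;> cases t <;> simp [h]
      · cases s <;> cases t <;> simp [weight] at h ⊢
    · cases s <;> cases t <;>
        simp [cornerLeft, coordBasis, cornerRight, cornerIdem, block_mul_block, smul_smul]

/-- For `k ≠ 0` the compression of any other element is zero. For `k = 0` only `eps` and the
`false`, `false` block have weight 0, and the only foreign element surviving compression is the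
`true`, `true` block, fixed by `eps` and of weight 2. -/
lemma corner_mem_of_ne {o o' : Option (Bool × Bool)}
    (ho : coordValency F V ≠ 0 ∨ weight o = 0) (hne : o' ≠ o) :
    cornerLeft v o * coordBasis F v o' * cornerRight v o ∈ coordFilt F v 1 := by
  by_cases hk : coordValency F V = 0
  · have hw := ho.resolve_left (not_not.2 hk)
    rcases o with _ | ⟨s, t⟩ <;> rcases o' with _ | ⟨s', t'⟩
    · exact absurd rfl hne
    · simp only [cornerLeft, coordBasis, cornerRight, eps_mul_block, smul_mul_assoc,
        block_mul_eps]
      cases s' <;> cases t' <;> simp [hk]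
      exact coordBasis_mem_coordFilt (o := some (true, true)) v (Or.inr ⟨hk, by simp [weight]⟩)
    · cases s <;> cases t <;> simp [weight] at hw
      simp [cornerLeft, coordBasis, block_mul_eps]
    · cases s <;> cases t <;> simp [weight] at hw
      cases s' <;> cases t' <;>
        simp [cornerLeft, coordBasis, cornerRight, block_mul_block] at hne ⊢
  · convert Submodule.zero_mem _
    rcases o with _ | ⟨s, t⟩ <;> rcases o' with _ | ⟨s', t'⟩
    · exact absurd rfl hne
    · simp [cornerLeft, coordBasis, eps_mul_block, hk]
    · simp [cornerLeft, coordBasis, block_mul_eps, hk]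
    · simp only [cornerLeft, coordBasis, cornerRight, block_mul_block, smul_mul_assoc]
      by_cases h : s = s'
      · by_cases h' : t' = t
        · exact absurd (by rw [h, h']) hne
        · simp [h']
      · simp [h]

end Coordinate

end FactorialScheme

namespace FactorialScheme

/-- Induction on the set of arguments known only to lie in the span, using linearity in one argument
at a time. -/
lemma _root_.MultilinearMap.map_mem_span {R ι M' : Type*} {M : ι → Type*} [CommSemiring R]
    [Fintype ι] [∀ i, AddCommMonoid (M i)] [∀ i, Module R (M i)]
    [AddCommMonoid M'] [Module R M'] (f : MultilinearMap R M M') (s : ∀ i, Set (M i))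
    {m : ∀ i, M i} (hm : ∀ i, m i ∈ Submodule.span R (s i)) :
    f m ∈ Submodule.span R {z | ∃ m' : ∀ i, M i, (∀ i, m' i ∈ s i) ∧ z = f m'} := by
  classical
  suffices h : ∀ (t : Finset ι) (m : ∀ i, M i), (∀ i ∈ t, m i ∈ Submodule.span R (s i)) →
      (∀ i ∉ t, m i ∈ s i) →
      f m ∈ Submodule.span R {z | ∃ m' : ∀ i, M i, (∀ i, m' i ∈ s i) ∧ z = f m'} from
    h Finset.univ m (fun i _ => hm i) (fun i hi => absurd (Finset.mem_univ i) hi)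
  intro t
  induction t using Finset.induction_on with
  | empty => exact fun m _ h => Submodule.subset_span ⟨m, fun i => h i (by simp), rfl⟩
  | insert a t ha ih =>
    intro m h h'
    have key : Submodule.span R (s a) ≤ (Submodule.span R
        {z | ∃ m' : ∀ i, M i, (∀ i, m' i ∈ s i) ∧ z = f m'}).comap (f.toLinearMap m a) := by
      rw [Submodule.span_le]
      intro v hv
      refine ih _ (fun i hi => ?_) (fun i hi => ?_)
      · have hia : i ≠ a := fun e => ha (e ▸ hi)
        rw [Function.update_of_ne hia]
        exact h i (Finset.mem_insert_of_mem hi)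
      · by_cases hia : i = a
        · subst hia
          rwa [Function.update_self]
        · rw [Function.update_of_ne hia]
          exact h' i (by simp [hia, hi])
    have := key (h a (Finset.mem_insert_self a t))
    rwa [Submodule.mem_comap, MultilinearMap.toLinearMap_apply, Function.update_eq_self] at this

/-! ### Kronecker products and the product filtration. -/

noncomputable section Tensor

open Matrix

set_option linter.unusedSectionVars false

variable {F : Type*} [Field F] {n : ℕ} {U : Fin n → Type*}

/-- The Kronecker product of a family of matrices. -/
def tens (M : ∀ i, Matrix (U i) (U i) F) : Matrix (∀ i, U i) (∀ i, U i) F :=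
  Matrix.of fun y z => ∏ i, M i (y i) (z i)

lemma tens_apply (M : ∀ i, Matrix (U i) (U i) F) (y z : ∀ i, U i) :
    tens M y z = ∏ i, M i (y i) (z i) := rfl

variable (F U) in
/-- The Kronecker product, as a multilinear map. -/
def tensMultilinear : MultilinearMap F (fun i => Matrix (U i) (U i) F)
    (Matrix (∀ i, U i) (∀ i, U i) F) :=
  MultilinearMap.mk' tens
    (fun m i a b => by
      ext y z
      exact ((MultilinearMap.mkPiAlgebra F (Fin n) F).compLinearMap
        fun i => Matrix.entryLinearMap F F (y i) (z i)).map_update_add m i a b)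
    (fun m i c a => by
      ext y z
      exact ((MultilinearMap.mkPiAlgebra F (Fin n) F).compLinearMap
        fun i => Matrix.entryLinearMap F F (y i) (z i)).map_update_smul m i c a)

lemma tensMultilinear_apply (M : ∀ i, Matrix (U i) (U i) F) : tensMultilinear F U M = tens M :=
  rfl

lemma tens_smul (c : Fin n → F) (M : ∀ i, Matrix (U i) (U i) F) :
    tens (fun i => c i • M i) = (∏ i, c i) • tens M := by
  ext y z
  simp [tens_apply, Finset.prod_mul_distrib]

lemma tens_eq_zero {M : ∀ i, Matrix (U i) (U i) F} (i : Fin n) (h : M i = 0) : tens M = 0 := by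
  ext y z
  rw [tens_apply]
  exact Finset.prod_eq_zero (Finset.mem_univ i) (by simp [h])

lemma tens_ne_zero {M : ∀ i, Matrix (U i) (U i) F} (h : ∀ i, M i ≠ 0) : tens M ≠ 0 := by
  have h' : ∀ i, ∃ y z, M i y z ≠ 0 := by
    intro i
    by_contra! hi
    exact h i (Matrix.ext hi)
  choose y z hyz using h'
  intro h0
  have := congrFun (congrFun h0 y) z
  rw [tens_apply] at this
  exact Finset.prod_ne_zero_iff.2 (fun i _ => hyz i) this

variable [∀ i, Fintype (U i)] [∀ i, DecidableEq (U i)]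

lemma tens_mul (M N : ∀ i, Matrix (U i) (U i) F) :
    tens M * tens N = tens fun i => M i * N i := by
  ext y z
  simp only [Matrix.mul_apply, tens_apply, ← Finset.prod_mul_distrib]
  rw [Finset.prod_univ_sum, Fintype.piFinset_univ]

lemma tens_one : tens (fun i => (1 : Matrix (U i) (U i) F)) = 1 := by
  ext y z
  simp only [tens_apply, Matrix.one_apply, Finset.prod_ite_zero, Finset.prod_const_one]
  simp [funext_iff]

variable (F) in
/-- The product of the radical filtrations of the coordinates. -/
def filt (x : ∀ i, U i) (d : ℕ) : Submodule F (Matrix (∀ i, U i) (∀ i, U i) F) :=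
  Submodule.span F {t | ∃ (M : ∀ i, Matrix (U i) (U i) F) (w : Fin n → ℕ),
    ∑ i, w i = d ∧ (∀ i, M i ∈ coordFilt F (x i) (w i)) ∧ t = tens M}

variable {x : ∀ i, U i}

lemma tens_mem_filt {M : ∀ i, Matrix (U i) (U i) F} (w : Fin n → ℕ)
    (h : ∀ i, M i ∈ coordFilt F (x i) (w i)) : tens M ∈ filt F x (∑ i, w i) :=
  Submodule.subset_span ⟨M, w, rfl, h, rfl⟩

lemma tens_mem_filt_zero {M : ∀ i, Matrix (U i) (U i) F}
    (h : ∀ i, M i ∈ coordFilt F (x i) 0) : tens M ∈ filt F x 0 := by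
  simpa using tens_mem_filt (fun _ => 0) h

lemma tens_mem_filt_one {M : ∀ i, Matrix (U i) (U i) F}
    (h : ∀ i, M i ∈ coordFilt F (x i) 0) (i : Fin n) (hi : M i ∈ coordFilt F (x i) 1) :
    tens M ∈ filt F x 1 := by
  have := tens_mem_filt (x := x) (M := M) (Pi.single i 1) (fun j => by
    by_cases hj : j = i
    · subst hj
      simpa using hi
    · simpa [hj] using h j)
  simpa using this

lemma filt_mul_mem {d e : ℕ} {s t : Matrix (∀ i, U i) (∀ i, U i) F} (hs : s ∈ filt F x d)
    (ht : t ∈ filt F x e) : s * t ∈ filt F x (d + e) := by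
  have key : filt F x d * filt F x e ≤ filt F x (d + e) := by
    rw [filt, filt, Submodule.span_mul_span, Submodule.span_le]
    rintro _ ⟨_, ⟨M, w, rfl, hM, rfl⟩, _, ⟨N, w', rfl, hN, rfl⟩, rfl⟩
    simp only [tens_mul]
    rw [← Finset.sum_add_distrib]
    exact tens_mem_filt (fun i => w i + w' i) fun i => coordFilt_mul_mem (x i) (hM i) (hN i)
  exact key (Submodule.mul_mem_mul hs ht)

lemma one_mem_filt_zero : (1 : Matrix (∀ i, U i) (∀ i, U i) F) ∈ filt F x 0 := by
  rw [← tens_one]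
  exact tens_mem_filt_zero fun i => one_mem_coordFilt_zero (x i)

lemma list_prod_mem_filt (l : List (Matrix (∀ i, U i) (∀ i, U i) F))
    (h : ∀ t ∈ l, t ∈ filt F x 1) : l.prod ∈ filt F x l.length := by
  induction l with
  | nil => exact one_mem_filt_zero
  | cons a l ih =>
    rw [List.prod_cons, List.length_cons, add_comm]
    exact filt_mul_mem (h a (by simp)) (ih fun t ht => h t (by simp [ht]))

open scoped Classical in
variable (F U) in
/-- The positions at which the valency vanishes in `F`. -/
def degenerate : Finset (Fin n) :=
  Finset.univ.filter fun i => (Fintype.card (U i) : F) = 1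

lemma mem_degenerate (i : Fin n) : i ∈ degenerate F U ↔ coordValency F (U i) = 0 := by
  simp [degenerate, coordValency, sub_eq_zero]

lemma eq_zero_of_mem_filt {t : Matrix (∀ i, U i) (∀ i, U i) F}
    (ht : t ∈ filt F x (2 * (degenerate F U).card + 1)) : t = 0 := by
  rw [← Submodule.mem_bot F]
  refine (Submodule.span_le.2 ?_) ht
  rintro _ ⟨M, w, hw, hM, rfl⟩
  simp only [Submodule.bot_coe, Set.mem_singleton_iff]
  by_contra h0
  -- A nonzero factor allows weight at most 2 at a degenerate position and 0 elsewhere, which bounds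
  -- the total weight by `2m`.
  have h : ∀ i, w i ≤ if i ∈ degenerate F U then 2 else 0 := by
    intro i
    have := le_two_of_mem_coordFilt (x i) (hM i) (fun h => h0 (tens_eq_zero i h))
    split_ifs with hi
    · exact this.1
    · exact (this.2 (fun h => hi ((mem_degenerate i).2 h))).le
  have := Finset.sum_le_sum fun i (_ : i ∈ Finset.univ) => h i
  rw [hw, Finset.sum_ite_mem, Finset.univ_inter, Finset.sum_const, smul_eq_mul] at this
  omega

/-- Powers of `s` are congruent to powers of `a` times `e` modulo `filt F x 1`, so nilpotency of `s`
puts `e` there; an idempotent equals its own high powers, which vanish. -/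
lemma eq_zero_of_sub_smul_mem_filt_one {s e : Matrix (∀ i, U i) (∀ i, U i) F} {a : F}
    (hs0 : s ∈ filt F x 0) (he0 : e ∈ filt F x 0) (he : e * e = e) (ha : a ≠ 0)
    (hs : IsNilpotent s) (h : s - a • e ∈ filt F x 1) : e = 0 := by
  have hpow : ∀ k : ℕ, s ^ (k + 1) - a ^ (k + 1) • e ∈ filt F x 1 := by
    intro k
    induction k with
    | zero => simpa using h
    | succ k ih =>
      have heq : s ^ (k + 1 + 1) - a ^ (k + 1 + 1) • e =
          (s ^ (k + 1) - a ^ (k + 1) • e) * s + a ^ (k + 1) • (e * (s - a • e)) := by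
        rw [sub_mul, mul_sub, mul_smul_comm, he, smul_sub, smul_smul, ← pow_succ, ← pow_succ,
          smul_mul_assoc]
        abel
      rw [heq]
      exact add_mem (filt_mul_mem (d := 1) (e := 0) ih hs0)
        (Submodule.smul_mem _ _ (filt_mul_mem (d := 0) (e := 1) he0 h))
  obtain ⟨k, hk⟩ := hs
  have he1 : e ∈ filt F x 1 := by
    have := hpow k
    rw [pow_succ s, hk, zero_mul, zero_sub, neg_mem_iff] at this
    exact (Submodule.smul_mem_iff _ (pow_ne_zero _ ha)).1 this
  apply eq_zero_of_mem_filt (x := x)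
  have := list_prod_mem_filt (List.replicate (2 * (degenerate F U).card + 1) e)
    fun t ht => List.eq_of_mem_replicate ht ▸ he1
  rwa [List.prod_replicate, List.length_replicate, IsIdempotentElem.pow_succ_eq _ he] at this

/-- An element of the algebra that generates a nil ideal lies in the first filtration step. -/
lemma mem_filt_one_of_isNilpotent {t : Matrix (∀ i, U i) (∀ i, U i) F} (ht : t ∈ filt F x 0)
    (hnil : ∀ l ∈ filt F x 0, ∀ r ∈ filt F x 0, IsNilpotent (l * t * r)) :
    t ∈ filt F x 1 := by
  let D : (Fin n → Option (Bool × Bool)) → Matrix (∀ i, U i) (∀ i, U i) F :=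
    fun f => tens fun i => coordBasis F (x i) (f i)
  have hspan : filt F x 0 ≤ Submodule.span F (Set.range D) := by
    rw [filt, Submodule.span_le]
    rintro _ ⟨M, w, hw, hM, rfl⟩
    have hw0 : ∀ i, w i = 0 := by simpa using hw
    refine Submodule.span_mono ?_ ((tensMultilinear F U).map_mem_span _ hM)
    rintro _ ⟨m, hm, rfl⟩
    choose o _ ho using hm
    exact ⟨o, by simp only [D, ho]; rfl⟩
  obtain ⟨c, hc⟩ := (Submodule.mem_span_range_iff_exists_fun F).1 (hspan ht)
  have hD0 : ∀ (f : Fin n → Option (Bool × Bool)) (i : Fin n), coordBasis F (x i) (f i) ∈ coordFilt F (x i) 0 :=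
    fun f i => coordBasis_mem_coordFilt _ (Or.inl rfl)
  rw [← hc]
  refine Submodule.sum_mem _ fun f _ => ?_
  -- Terms with positive weight at a degenerate position already lie in step 1; the coefficients of
  -- all other nonzero terms must vanish.
  by_cases hss : ∀ i, coordValency F (U i) ≠ 0 ∨ weight (f i) = 0
  swap
  · push Not at hss
    obtain ⟨i, hk, hw⟩ := hss
    exact Submodule.smul_mem _ _ (tens_mem_filt_one (hD0 f) i
      (coordBasis_mem_coordFilt _ (Or.inr ⟨hk, Nat.one_le_iff_ne_zero.2 hw⟩)))
  -- `eps` is zero on a factor with two points, so `D f` can vanish and leave `c f` undetermined.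
  by_cases hDf : D f = 0
  · simp [hDf]
  suffices hcf : c f = 0 by simp [hcf]
  by_contra hcf
  choose κ hκ0 hκ using fun i => exists_corner_self (x i) (hss i)
  set l : Matrix (∀ i, U i) (∀ i, U i) F := tens fun i => cornerLeft (x i) (f i) with hl
  set r : Matrix (∀ i, U i) (∀ i, U i) F := tens fun i => cornerRight (x i) (f i) with hr
  have hl0 : l ∈ filt F x 0 := tens_mem_filt_zero fun i => cornerLeft_mem (x i) (f i)
  have hr0 : r ∈ filt F x 0 := tens_mem_filt_zero fun i => cornerRight_mem (x i) (f i)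
  have hself : l * D f * r = (∏ i, κ i) • tens fun i => cornerIdem (x i) (f i) := by
    rw [hl, hr, tens_mul, tens_mul, ← tens_smul]
    simp only [hκ]
  have hother : ∀ g, g ≠ f → l * D g * r ∈ filt F x 1 := by
    intro g hg
    obtain ⟨i, hi⟩ := Function.ne_iff.1 hg
    rw [hl, hr, tens_mul, tens_mul]
    refine tens_mem_filt_one (fun j => ?_) i (corner_mem_of_ne (x i) (hss i) hi)
    exact coordFilt_mul_mem (d := 0) (e := 0) _ (coordFilt_mul_mem (d := 0) (e := 0) _
      (cornerLeft_mem (x j) (f j)) (hD0 g j)) (cornerRight_mem (x j) (f j))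
  refine tens_ne_zero (fun i => cornerIdem_ne_zero (x i) fun h => hDf (tens_eq_zero i h))
    (eq_zero_of_sub_smul_mem_filt_one (a := c f * ∏ i, κ i)
      (filt_mul_mem (d := 0) (e := 0) (filt_mul_mem (d := 0) (e := 0) hl0 ht) hr0)
      (tens_mem_filt_zero fun i => ?_) ?_ ?_ (hnil l hl0 r hr0) ?_)
  · exact cornerIdem_mem (x i) (f i)
  · rw [tens_mul]
    simp only [cornerIdem_mul_self]
  · exact mul_ne_zero hcf (Finset.prod_ne_zero_iff.2 fun i _ => hκ0 i)
  · rw [← hc, Finset.mul_sum, Finset.sum_mul, ← Finset.add_sum_erase _ _ (Finset.mem_univ f),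
      mul_smul_comm, smul_mul_assoc, hself, mul_smul, add_sub_cancel_left]
    refine Submodule.sum_mem _ fun g hg => ?_
    rw [mul_smul_comm, smul_mul_assoc]
    exact Submodule.smul_mem _ _ (hother g (Finset.ne_of_mem_erase hg))

/-- The Kronecker product with the given matrix at position `i` and ones elsewhere. -/
def tensAt (i : Fin n) (M : Matrix (U i) (U i) F) : Matrix (∀ i, U i) (∀ i, U i) F :=
  tens (Function.update (fun _ => 1) i M)

lemma tensAt_block_mem_filt_one {i : Fin n} (hi : i ∈ degenerate F U) {s t : Bool}
    (hst : s = true ∨ t = true) : tensAt i (block F (x i) s t) ∈ filt F x 1 := by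
  refine tens_mem_filt_one (fun j => ?_) i ?_
  · by_cases hj : j = i
    · subst hj
      simpa using block_mem_coordFilt_zero (x j) s t
    · simpa [hj] using one_mem_coordFilt_zero (x j)
  · rw [Function.update_self]
    refine coordBasis_mem_coordFilt (o := some (s, t)) (x i)
      (Or.inr ⟨(mem_degenerate i).1 hi, ?_⟩)
    rcases hst with rfl | rfl <;> simp [weight]

lemma tensAt_mul_tensAt_mul_tens (i : Fin n) (l : List (Fin n)) (hi : i ∉ l) :
    tensAt i (block F (x i) true false) * (tensAt i (block F (x i) false true) *
      tens fun j => if j ∈ l then block F (x j) true true else 1) =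
    tens fun j => if j ∈ i :: l then block F (x j) true true else 1 := by
  rw [tensAt, tensAt, tens_mul, tens_mul]
  congr 1
  funext j
  by_cases hj : j = i
  · subst hj
    simp [hi, block_mul_block]
  · simp [hj]

lemma block_true_true_ne_zero {V : Type*} [Fintype V] [DecidableEq V]
    (hV : 2 ≤ Fintype.card V) (v : V) : block F v true true ≠ 0 := by
  have := Fintype.one_lt_card_iff_nontrivial.1 hV
  obtain ⟨y, hy⟩ := exists_ne v
  intro h
  have := congrFun (congrFun h y) y
  simp [block, vecMulVec_apply, ind, hy] at this

/-- Each degenerate position contributes two factors of weight 1, whose product is the nonzero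
`true`, `true` block. -/
lemma exists_list_prod_ne_zero (hU : ∀ i, 2 ≤ Fintype.card (U i)) (x : ∀ i, U i) :
    ∃ l : List (Matrix (∀ i, U i) (∀ i, U i) F), l.length = 2 * (degenerate F U).card ∧
      (∀ t ∈ l, t ∈ filt F x 1) ∧ l.prod ≠ 0 := by
  have key : ∀ S : List (Fin n), S.Nodup → (∀ i ∈ S, i ∈ degenerate F U) →
      ∃ l : List (Matrix (∀ i, U i) (∀ i, U i) F), l.length = 2 * S.length ∧
        (∀ t ∈ l, t ∈ filt F x 1) ∧
        l.prod = tens fun j => if j ∈ S then block F (x j) true true else 1 := by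
    intro S
    induction S with
    | nil => exact fun _ _ => ⟨[], by simp, by simp, by simpa using tens_one.symm⟩
    | cons i S ih =>
      intro hS hS'
      obtain ⟨hi, hS⟩ := List.nodup_cons.1 hS
      obtain ⟨l, hl, hl', hl''⟩ := ih hS fun j hj => hS' j (by simp [hj])
      have hi' := hS' i (by simp)
      refine ⟨tensAt i (block F (x i) true false) :: tensAt i (block F (x i) false true) :: l,
        by simp [hl]; ring, ?_, ?_⟩
      · intro t ht
        rcases List.mem_cons.1 ht with rfl | ht
        · exact tensAt_block_mem_filt_one hi' (Or.inl rfl)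
        rcases List.mem_cons.1 ht with rfl | ht
        · exact tensAt_block_mem_filt_one hi' (Or.inr rfl)
        · exact hl' t ht
      · rw [List.prod_cons, List.prod_cons, hl'', tensAt_mul_tensAt_mul_tens i S hi]
  obtain ⟨l, hl, hl', hl''⟩ := key (degenerate F U).toList (Finset.nodup_toList _)
    fun i hi => Finset.mem_toList.1 hi
  refine ⟨l, by rw [hl, Finset.length_toList], hl', ?_⟩
  rw [hl'']
  refine tens_ne_zero fun i => ?_
  have : Nonempty (U i) := ⟨x i⟩
  split_ifs
  · exact block_true_true_ne_zero (hU i) (x i)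
  · exact one_ne_zero

end Tensor

end FactorialScheme

namespace FactorialScheme

/-! ### The matrices `B_{a,b,c}` in terms of the filtration. -/

noncomputable section Link

open Matrix

set_option linter.unusedSectionVars false

section Coordinate

variable {F : Type*} [Field F] {V : Type*} [Fintype V] [DecidableEq V] (v : V)

variable (F) in
/-- The coordinates of the matrices `B_{a,b,c}`. -/
def coordB (a b c : Bool) : Matrix V V F :=
  if b then block F v a c else if a = c then diagonal (ind F v a) else 0

variable (V) in
/-- The condition `a ⊕ b ⊆ c ⊆ a ⊙ b` at one coordinate. -/
def CoordAdmissible (a b c : Bool) : Prop :=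
  (a ≠ b → c = true) ∧ (c = true → a ≠ b ∨ (a = true ∧ b = true ∧ 2 < Fintype.card V))

lemma coordFilt_antitone : Antitone (coordFilt F v) := by
  intro d e hde
  refine Submodule.span_mono (Set.image_mono ?_)
  rintro o (rfl | ⟨hk, ho⟩)
  · exact Or.inl (by omega)
  · exact Or.inr ⟨hk, hde.trans ho⟩

lemma coordB_mem_coordFilt_zero (a b c : Bool) : coordB F v a b c ∈ coordFilt F v 0 := by
  unfold coordB
  split_ifs
  · exact block_mem_coordFilt_zero v _ _
  · exact diagonal_ind_mem_coordFilt_zero v _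
  · exact zero_mem _

lemma coordB_mem_coordFilt_one {a c : Bool} (h : CoordAdmissible V a true c)
    (hk : coordValency F V = 0) : coordB F v a true c ∈ coordFilt F v 1 := by
  refine coordBasis_mem_coordFilt (o := some (a, c)) v (Or.inr ⟨hk, ?_⟩)
  cases a <;> cases c <;> simp [CoordAdmissible, weight] at h ⊢

/-- Admissibility only discards zero or repeated matrices. -/
lemma block_mem_span_coordB (hV : 2 ≤ Fintype.card V) (s t : Bool) :
    block F v s t ∈ Submodule.span F
      {M | ∃ a b c, CoordAdmissible V a b c ∧ M = coordB F v a b c} := by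
  cases s <;> cases t
  · exact Submodule.subset_span ⟨false, false, false, by simp [CoordAdmissible],
      by simp [coordB, diagonal_ind_false]⟩
  · exact Submodule.subset_span ⟨false, true, true, by simp [CoordAdmissible],
      by simp [coordB]⟩
  · exact Submodule.subset_span ⟨true, true, false, by simp [CoordAdmissible],
      by simp [coordB]⟩
  · by_cases h : 2 < Fintype.card V
    · exact Submodule.subset_span ⟨true, true, true, by simp [CoordAdmissible, h],
        by simp [coordB]⟩
    · have h2 : Fintype.card V = 2 := by omega
      -- With two points the complement of `v` is a single point, so the `true`, `true` block is the
      -- diagonal idempotent.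
      refine Submodule.subset_span ⟨true, false, true, by simp [CoordAdmissible], ?_⟩
      have hunique : ∀ y z : V, y ≠ v → z ≠ v → y = z := by
        intro y z hy hz
        by_contra hyz
        apply h
        rw [Fintype.two_lt_card_iff]
        exact ⟨v, y, z, hy.symm, hz.symm, hyz⟩
      ext y z
      by_cases hy : y = v
      · simp [block, vecMulVec_apply, coordB, diagonal_apply, ind, hy]
      · by_cases hz : z = v
        · simp +contextual [block, vecMulVec_apply, coordB, diagonal_apply, ind, hz]
        · obtain rfl := hunique y z hy hz
          simp [block, vecMulVec_apply, coordB, ind, hy]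

lemma coordFilt_zero_le_span (hV : 2 ≤ Fintype.card V) :
    coordFilt F v 0 ≤ Submodule.span F
      {M | ∃ a b c, CoordAdmissible V a b c ∧ M = coordB F v a b c} := by
  rw [coordFilt, Submodule.span_le]
  rintro _ ⟨o, -, rfl⟩
  rcases o with _ | ⟨s, t⟩
  · refine sub_mem (Submodule.subset_span ⟨true, false, true, by simp [CoordAdmissible], ?_⟩)
      (Submodule.smul_mem _ _ (block_mem_span_coordB v hV _ _))
    simp [coordB]
  · exact block_mem_span_coordB v hV s t

lemma coordFilt_one_le_span (hV : 2 ≤ Fintype.card V) :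
    coordFilt F v 1 ≤ Submodule.span F
      {M | ∃ a c, CoordAdmissible V a true c ∧ M = coordB F v a true c} := by
  rw [coordFilt, Submodule.span_le]
  rintro _ ⟨o, ho | ⟨hk, ho⟩, rfl⟩
  · exact absurd ho one_ne_zero
  -- Two points would give `k = 1`, which is never zero in a field.
  have h2 : 2 < Fintype.card V := by
    refine lt_of_le_of_ne hV fun h => ?_
    rw [coordValency, ← h] at hk
    norm_num at hk
  rcases o with _ | ⟨s, t⟩
  · simp [weight] at ho
  · refine Submodule.subset_span ⟨s, t, ?_, by simp [coordB, coordBasis]⟩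
    cases s <;> cases t <;> simp [weight, CoordAdmissible, h2] at ho ⊢

end Coordinate

variable {F : Type*} [Field F] {n : ℕ} {U : Fin n → Type*} [∀ i, Fintype (U i)]
  [∀ i, DecidableEq (U i)]

lemma adjMatrix_eq_tens (g : Finset (Fin n)) :
    (adjMatrix F g : Matrix (∀ i, U i) (∀ i, U i) F) = tens fun i =>
      if i ∈ g then Matrix.of fun y z => if y ≠ z then 1 else 0 else 1 := by
  ext y z
  have h : ∀ i, (if i ∈ g then Matrix.of fun y z => if y ≠ z then 1 else 0 else 1 :
      Matrix (U i) (U i) F) (y i) (z i) = if (y i ≠ z i ↔ i ∈ g) then 1 else 0 := by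
    intro i
    by_cases hi : i ∈ g <;> by_cases hyz : y i = z i <;> simp [hi, hyz, one_apply]
  simp only [tens_apply, h, Finset.prod_ite_zero, Finset.prod_const_one]
  exact if_congr (by simp [Rel]) rfl rfl

lemma ind_eq_ite {V : Type*} [DecidableEq V] (v y : V) (P : Prop) [Decidable P] :
    ind F v (decide P) y = if (v ≠ y ↔ P) then 1 else 0 := by
  by_cases h : v = y
  · subst h
    by_cases hP : P <;> simp [ind, hP]
  · by_cases hP : P <;> simp [ind, hP, h, Ne.symm h]

lemma prod_ind (x y : ∀ i, U i) (g : Finset (Fin n)) :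
    ∏ i, ind F (x i) (decide (i ∈ g)) (y i) = if Rel g x y then 1 else 0 := by
  simp only [ind_eq_ite, Finset.prod_ite_zero, Finset.prod_const_one]
  exact if_congr (by simp [Rel]) rfl rfl

lemma dualIdempotent_eq_tens (x : ∀ i, U i) (g : Finset (Fin n)) :
    dualIdempotent F x g = tens fun i => diagonal (ind F (x i) (decide (i ∈ g))) := by
  ext y z
  rw [dualIdempotent, diagonal_apply, tens_apply]
  by_cases h : y = z
  · subst h
    simp only [diagonal_apply_eq, prod_ind, if_true]
  · obtain ⟨i, hi⟩ := Function.ne_iff.1 h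
    rw [if_neg h, Finset.prod_eq_zero (Finset.mem_univ i)]
    rw [diagonal_apply_ne _ hi]

lemma rel_iff_eq_filter (j : Finset (Fin n)) (y z : ∀ i, U i) :
    Rel j y z ↔ (Finset.univ.filter fun i => y i ≠ z i) = j := by
  rw [Finset.ext_iff]
  simp [Rel]

/-- Only one `j` can contribute to a given entry: the set of positions where `y` and `z` differ. -/
lemma elemB_apply (x : ∀ i, U i) (a b c : Finset (Fin n)) (y z : ∀ i, U i) :
    (elemB F x a b c : Matrix (∀ i, U i) (∀ i, U i) F) y z =
      if (Finset.univ.filter fun i => y i ≠ z i) ∈ Finset.Icc (oplus a c) b then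
        (if Rel a x y then 1 else 0) * (if Rel c x z then 1 else 0) else 0 := by
  have h : ∀ j, (dualIdempotent F x a * adjMatrix F j * dualIdempotent F x c :
      Matrix (∀ i, U i) (∀ i, U i) F) y z =
      if (Finset.univ.filter fun i => y i ≠ z i) = j then
        (if Rel a x y then 1 else 0) * (if Rel c x z then 1 else 0) else 0 := by
    intro j
    rw [dualIdempotent, dualIdempotent, mul_diagonal, diagonal_mul, adjMatrix, of_apply]
    simp only [rel_iff_eq_filter j]
    split_ifs <;> simp
  rw [elemB]
  simp only [AddSubmonoidClass.coe_finsetSum, Subalgebra.coe_mul, elemE, elemA,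
    Matrix.sum_apply, h, Finset.sum_ite_eq]

lemma coordB_apply {V : Type*} [Fintype V] [DecidableEq V] (v y z : V) (A B C : Prop)
    [Decidable A] [Decidable B] [Decidable C] :
    coordB F v (decide A) (decide B) (decide C) y z =
      if ((v ≠ y ↔ A) ∧ (v ≠ z ↔ C) ∧ (y ≠ z → B)) then 1 else 0 := by
  unfold coordB
  by_cases hB : B
  · simp only [hB, decide_true, if_true, block, vecMulVec_apply, ind_eq_ite, implies_true,
      and_true, ite_and]
    split_ifs <;> simp
  · simp only [hB, decide_false]
    by_cases hyz : y = z
    · subst hyz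
      by_cases hA : A <;> by_cases hC : C <;> by_cases hy : v = y <;>
        simp [hA, hC, hy, ind, eq_comm]
    · by_cases hA : A <;> by_cases hC : C <;> simp [hA, hC, hyz]

lemma elemB_eq_tens (x : ∀ i, U i) (a b c : Finset (Fin n)) :
    (elemB F x a b c : Matrix (∀ i, U i) (∀ i, U i) F) = tens fun i =>
      coordB F (x i) (decide (i ∈ a)) (decide (i ∈ b)) (decide (i ∈ c)) := by
  ext y z
  simp only [elemB_apply, tens_apply, coordB_apply, Finset.prod_ite_zero, Finset.prod_const_one,
    ← ite_and, mul_ite, mul_one, mul_zero]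
  refine if_congr ?_ rfl rfl
  simp only [Finset.mem_Icc, Finset.subset_iff, Finset.mem_filter,
    Finset.mem_univ, true_and, forall_const, Rel, oplus, Finset.mem_union, Finset.mem_sdiff]
  constructor
  · rintro ⟨⟨-, h⟩, h', h''⟩ i
    exact ⟨h'' i, h' i, fun hi => h hi⟩
  · intro h
    -- The lower bound `a ⊕ c ⊆ j` is automatic: at a position in exactly one of `a` and `c`,
    -- exactly one of `y` and `z` agrees with `x`.
    refine ⟨⟨fun i hi => ?_, fun i hi => (h i).2.2 hi⟩, fun i => (h i).2.1, fun i => (h i).1⟩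
    have := h i
    rintro e
    rw [e] at this
    tauto

lemma admissible_iff (a b c : Finset (Fin n)) :
    (oplus a b ⊆ c ∧ c ⊆ odot U a b) ↔
      ∀ i, CoordAdmissible (U i) (decide (i ∈ a)) (decide (i ∈ b)) (decide (i ∈ c)) := by
  simp only [CoordAdmissible, Finset.subset_iff, oplus, odot, tilde, Finset.mem_union,
    Finset.mem_sdiff, Finset.mem_filter, Finset.mem_inter, ne_eq, decide_eq_true_eq,
    decide_eq_decide, ← forall_and]
  refine forall_congr' fun i => ?_
  tauto

/-- The indicator function of `x R_b` is a product over the coordinates, so its sum factors. -/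
lemma natCast_valency (x : ∀ i, U i) (b : Finset (Fin n)) :
    (valency x b : F) = ∏ i ∈ b, coordValency F (U i) := by
  have h : (valency x b : F) = ∑ y : ∀ i, U i, if Rel b x y then 1 else 0 := by
    rw [valency, Fintype.card_subtype, Finset.sum_boole]
  rw [h]
  simp only [← prod_ind]
  have := Finset.prod_univ_sum (fun i => (Finset.univ : Finset (U i)))
    (fun i y => ind F (x i) (decide (i ∈ b)) y)
  rw [Fintype.piFinset_univ] at this
  rw [← this]
  simp only [sum_ind, decide_eq_true_eq]
  rw [Finset.prod_ite_mem, Finset.univ_inter]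

lemma dvd_valency_iff (p : ℕ) [CharP F p] (x : ∀ i, U i) (b : Finset (Fin n)) :
    p ∣ valency x b ↔ ∃ i ∈ b, coordValency F (U i) = 0 := by
  rw [← CharP.cast_eq_zero_iff F p, natCast_valency, Finset.prod_eq_zero_iff]

lemma tens_coordB_eq_elemB (x : ∀ i, U i) (a b c : Fin n → Bool) :
    tens (fun i => coordB F (x i) (a i) (b i) (c i)) =
      (elemB F x (Finset.univ.filter fun i => a i) (Finset.univ.filter fun i => b i)
        (Finset.univ.filter fun i => c i) : Matrix (∀ i, U i) (∀ i, U i) F) := by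
  simp [elemB_eq_tens]

lemma filt_zero_le_terwilligerAlgebra (hU : ∀ i, 2 ≤ Fintype.card (U i)) (x : ∀ i, U i) :
    filt F x 0 ≤ Subalgebra.toSubmodule (terwilligerAlgebra F x) := by
  rw [filt, Submodule.span_le]
  rintro _ ⟨M, w, hw, hM, rfl⟩
  have hw0 : ∀ i, w i = 0 := by simpa using hw
  refine Submodule.span_le.2 ?_ ((tensMultilinear F U).map_mem_span _
    fun i => coordFilt_zero_le_span (x i) (hU i) (hw0 i ▸ hM i))
  rintro _ ⟨m, hm, rfl⟩
  choose a b c _ h using hm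
  rw [tensMultilinear_apply, funext h, tens_coordB_eq_elemB]
  exact (elemB F x _ _ _).2

lemma terwilligerAlgebra_le_filt_zero (x : ∀ i, U i) :
    Subalgebra.toSubmodule (terwilligerAlgebra F x) ≤ filt F x 0 := by
  let S : Subalgebra F (Matrix (∀ i, U i) (∀ i, U i) F) := (filt F x 0).toSubalgebra
    one_mem_filt_zero fun s t hs ht => filt_mul_mem (d := 0) (e := 0) hs ht
  have h : terwilligerAlgebra F x ≤ S := by
    refine Algebra.adjoin_le ?_
    rintro _ (⟨g, rfl⟩ | ⟨g, rfl⟩)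
    · rw [dualIdempotent_eq_tens]
      exact tens_mem_filt_zero fun i => diagonal_ind_mem_coordFilt_zero (x i) _
    · rw [adjMatrix_eq_tens]
      refine tens_mem_filt_zero fun i => ?_
      split_ifs
      · exact compl_one_mem_coordFilt_zero (x i)
      · exact one_mem_coordFilt_zero (x i)
  exact h

lemma filt_one_le_filt_zero (x : ∀ i, U i) : filt F x 1 ≤ filt F x 0 := by
  rw [filt, Submodule.span_le]
  rintro _ ⟨M, w, -, hM, rfl⟩
  exact tens_mem_filt_zero fun i => coordFilt_antitone (x i) (Nat.zero_le _) (hM i)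

lemma mem_filt_zero_iff (hU : ∀ i, 2 ≤ Fintype.card (U i)) (x : ∀ i, U i)
    (t : Matrix (∀ i, U i) (∀ i, U i) F) : t ∈ filt F x 0 ↔ t ∈ terwilligerAlgebra F x :=
  ⟨fun h => filt_zero_le_terwilligerAlgebra hU x h, fun h => terwilligerAlgebra_le_filt_zero x h⟩

lemma coe_mem_filt_one {p : ℕ} [CharP F p] {x : ∀ i, U i} {t : terwilligerAlgebra F x}
    (ht : t ∈ spanB F p x) : (t : Matrix (∀ i, U i) (∀ i, U i) F) ∈ filt F x 1 := by
  have : spanB F p x ≤ (filt F x 1).comap (terwilligerAlgebra F x).val.toLinearMap := by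
    rw [spanB, Submodule.span_le]
    rintro _ ⟨a, b, c, h, h', hp, rfl⟩
    obtain ⟨i, hi, hk⟩ := (dvd_valency_iff (F := F) p x b).1 hp
    have hadm := (admissible_iff a b c).1 ⟨h, h'⟩ i
    change ((elemB F x a b c : terwilligerAlgebra F x) : Matrix _ _ F) ∈ filt F x 1
    rw [elemB_eq_tens]
    refine tens_mem_filt_one (fun j => coordB_mem_coordFilt_zero _ _ _ _) i ?_
    simp only [hi, decide_true] at hadm ⊢
    exact coordB_mem_coordFilt_one (x i) hadm hk
  exact this ht

lemma filt_one_le_map_spanB (hU : ∀ i, 2 ≤ Fintype.card (U i)) (p : ℕ) [CharP F p]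
    (x : ∀ i, U i) :
    filt F x 1 ≤ (spanB F p x).map (terwilligerAlgebra F x).val.toLinearMap := by
  rw [filt, Submodule.span_le]
  rintro _ ⟨M, w, hw, hM, rfl⟩
  obtain ⟨i, hi⟩ : ∃ i, 1 ≤ w i := by
    by_contra! h
    have : ∀ i, w i = 0 := fun i => by have := h i; omega
    simp [this] at hw
  have hMi : M i ∈ coordFilt F (x i) 1 := coordFilt_antitone (x i) hi (hM i)
  by_cases hk : coordValency F (U i) = 0
  swap
  · have h0 : M i = 0 := by
      by_contra h0
      exact one_ne_zero ((le_two_of_mem_coordFilt (x i) hMi h0).2 hk)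
    rw [tens_eq_zero i h0]
    exact zero_mem _
  -- Forcing `b` to be `true` at the degenerate position `i` is what yields `p ∣ k_b`.
  have hgen : ∀ j, M j ∈ Submodule.span F {N | ∃ a b c, CoordAdmissible (U j) a b c ∧
      (j = i → b = true) ∧ N = coordB F (x j) a b c} := by
    intro j
    by_cases hj : j = i
    · subst hj
      refine Submodule.span_mono ?_ (coordFilt_one_le_span (x j) (hU j) hMi)
      rintro _ ⟨a, c, h, rfl⟩
      exact ⟨a, true, c, h, fun _ => rfl, rfl⟩
    · refine Submodule.span_mono ?_ (coordFilt_zero_le_span (x j) (hU j)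
        (coordFilt_antitone (x j) (Nat.zero_le _) (hM j)))
      rintro _ ⟨a, b, c, h, rfl⟩
      exact ⟨a, b, c, h, fun h => absurd h hj, rfl⟩
  refine Submodule.span_le.2 ?_ ((tensMultilinear F U).map_mem_span _ hgen)
  rintro _ ⟨m, hm, rfl⟩
  choose a b c hadm hb h using hm
  rw [tensMultilinear_apply, funext h, tens_coordB_eq_elemB]
  obtain ⟨h1, h2⟩ := (admissible_iff (U := U) (Finset.univ.filter fun i => a i)
    (Finset.univ.filter fun i => b i) (Finset.univ.filter fun i => c i)).2 (by simpa using hadm)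
  exact Submodule.mem_map_of_mem (Submodule.subset_span ⟨_, _, _, h1, h2,
    (dvd_valency_iff (F := F) p x _).2 ⟨i, by simp [hb i rfl], hk⟩, rfl⟩)

lemma mem_spanB_iff (hU : ∀ i, 2 ≤ Fintype.card (U i)) (p : ℕ) [CharP F p] (x : ∀ i, U i)
    (t : terwilligerAlgebra F x) :
    t ∈ spanB F p x ↔ (t : Matrix (∀ i, U i) (∀ i, U i) F) ∈ filt F x 1 := by
  refine ⟨coe_mem_filt_one, fun h => ?_⟩
  obtain ⟨s, hs, hst⟩ := filt_one_le_map_spanB hU p x h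
  rwa [← Subtype.ext hst]

/-! ### The radical and its nilpotency. -/

variable (F) in
/-- The first step of the radical filtration, as a two-sided ideal of the Terwilliger algebra. -/
def filtIdeal (x : ∀ i, U i) : TwoSidedIdeal (terwilligerAlgebra F x) :=
  let I := (filt F x 1).comap (terwilligerAlgebra F x).val.toLinearMap
  TwoSidedIdeal.mk' I I.zero_mem I.add_mem I.neg_mem
    (fun {s t} h => show s * t ∈ I from
      filt_mul_mem (d := 0) (e := 1) (terwilligerAlgebra_le_filt_zero x s.2) h)
    (fun {s t} h => show s * t ∈ I from
      filt_mul_mem (d := 1) (e := 0) h (terwilligerAlgebra_le_filt_zero x t.2))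

lemma mem_filtIdeal {x : ∀ i, U i} {t : terwilligerAlgebra F x} :
    t ∈ filtIdeal F x ↔ (t : Matrix (∀ i, U i) (∀ i, U i) F) ∈ filt F x 1 := by
  rw [filtIdeal, TwoSidedIdeal.mem_mk']
  rfl

lemma productsVanish_filtIdeal (x : ∀ i, U i) :
    ProductsVanish (filtIdeal F x) (2 * (degenerate F U).card + 1) := by
  intro f hf
  apply Subtype.ext
  apply eq_zero_of_mem_filt (x := x)
  have := list_prod_mem_filt (x := x)
    ((List.ofFn f).map (terwilligerAlgebra F x).val) (by
      intro t ht
      obtain ⟨s, hs, rfl⟩ := List.mem_map.1 ht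
      obtain ⟨i, rfl⟩ := (List.mem_ofFn' _ _).1 hs
      exact mem_filtIdeal.1 (hf i))
  rw [List.length_map, List.length_ofFn] at this
  convert this
  exact map_list_prod (terwilligerAlgebra F x).val _

lemma list_prod_eq_zero_of_productsVanish {A : Type*} [Ring A] {I : TwoSidedIdeal A} {h : ℕ}
    (hI : ProductsVanish I h) (l : List A) (hl : ∀ t ∈ l, t ∈ I) (hlen : h ≤ l.length) :
    l.prod = 0 := by
  have key : ∀ l : List A, l.length = h → (∀ t ∈ l, t ∈ I) → l.prod = 0 := by
    rintro l rfl hl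
    have := hI l.get fun i => hl _ (List.get_mem l i)
    rwa [List.ofFn_get] at this
  rw [← List.prod_take_mul_prod_drop l h, key (l.take h) (by simpa using hlen)
    fun t ht => hl t (List.mem_of_mem_take ht), zero_mul]

lemma le_of_productsVanish_filtIdeal (hU : ∀ i, 2 ≤ Fintype.card (U i)) (x : ∀ i, U i) {h : ℕ}
    (hh : ProductsVanish (filtIdeal F x) h) : 2 * (degenerate F U).card + 1 ≤ h := by
  by_contra! hlt
  obtain ⟨l, hl, hl', hl''⟩ := exists_list_prod_ne_zero (F := F) hU x
  have hmem : ∀ t ∈ l, t ∈ terwilligerAlgebra F x := by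
    intro t ht
    exact (mem_filt_zero_iff hU x t).1 (filt_one_le_filt_zero x (hl' t ht))
  lift l to List (terwilligerAlgebra F x) using hmem
  refine hl'' ?_
  have := list_prod_eq_zero_of_productsVanish hh l (fun t ht => mem_filtIdeal.2
    (hl' t (List.mem_map_of_mem ht))) (by rw [List.length_map] at hl; omega)
  have h2 := map_list_prod (terwilligerAlgebra F x).val l
  rw [this, map_zero] at h2
  exact h2.symm

lemma le_filtIdeal_of_isNilpotentIdeal (hU : ∀ i, 2 ≤ Fintype.card (U i)) (x : ∀ i, U i)
    {I : TwoSidedIdeal (terwilligerAlgebra F x)} (hI : IsNilpotentIdeal I) :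
    I ≤ filtIdeal F x := by
  obtain ⟨h, -, hI⟩ := hI
  intro t ht
  refine mem_filtIdeal.2 (mem_filt_one_of_isNilpotent (terwilligerAlgebra_le_filt_zero x t.2)
    fun l hl r hr => ⟨h, ?_⟩)
  rw [mem_filt_zero_iff hU] at hl hr
  -- A constant family turns the vanishing of products into nilpotency of `l * t * r`.
  have := hI (fun _ => ⟨l, hl⟩ * t * ⟨r, hr⟩)
    fun _ => I.mul_mem_right _ _ (I.mul_mem_left _ _ ht)
  rw [List.ofFn_const, List.prod_replicate] at this
  exact congrArg Subtype.val this

lemma rad_eq_filtIdeal (hU : ∀ i, 2 ≤ Fintype.card (U i)) (x : ∀ i, U i) :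
    rad (terwilligerAlgebra F x) = filtIdeal F x :=
  le_antisymm (sSup_le fun _ hI => le_filtIdeal_of_isNilpotentIdeal hU x hI)
    (le_sSup ⟨_, by omega, productsVanish_filtIdeal x⟩)

lemma degenerate_eq_filter_modEq (p : ℕ) [CharP F p] :
    degenerate F U = Finset.univ.filter fun i => Fintype.card (U i) ≡ 1 [MOD p] := by
  ext i
  simp [degenerate, ← CharP.natCast_eq_natCast F p]

end Link

end FactorialScheme

theorem theorem7p12 {n : ℕ} (hn : 1 ≤ n) (U : Fin n → Type*) [∀ i, Fintype (U i)]
    [∀ i, DecidableEq (U i)] (hU : ∀ i, 2 ≤ Fintype.card (U i))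
    (F : Type*) [Field F] (p : ℕ) [CharP F p] (x : ∀ i, U i) :
    (FactorialScheme.rad (FactorialScheme.terwilligerAlgebra F x) :
        Set (FactorialScheme.terwilligerAlgebra F x)) =
      (FactorialScheme.spanB F p x : Set (FactorialScheme.terwilligerAlgebra F x)) ∧
    FactorialScheme.HasNilpotency
      (FactorialScheme.rad (FactorialScheme.terwilligerAlgebra F x))
      (2 * (Finset.univ.filter fun i => Fintype.card (U i) ≡ 1 [MOD p]).card + 1) := by
  rw [FactorialScheme.rad_eq_filtIdeal hU, ← FactorialScheme.degenerate_eq_filter_modEq (F := F)]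
  refine ⟨?_, ⟨by omega, FactorialScheme.productsVanish_filtIdeal x⟩,
    fun h hh => FactorialScheme.le_of_productsVanish_filtIdeal hU x hh.2⟩
  ext t
  exact FactorialScheme.mem_filtIdeal.trans (FactorialScheme.mem_spanB_iff hU p x t).symm
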